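/- Consider a sequence, indexed by $\nu\in\mathbb N$, of noisy multiple measurement vector problems $Y=AX+W$ (all quantities depend on $\nu$), where $A\in\mathbb R^{m\times n}$ has i.i.d. $N(0,1/m)$ entries and columns (atoms) $\mathbf a_1,\dots,\mathbf a_n$, $X\in\mathbb R^{n\times N}$ is a fixed matrix with exactly $k$ nonzero rows, $\operatorname{supp}X$ is the set of their indices, and the noise $W\in\mathbb R^{m\times N}$ is independent of $A$ (of arbitrary distribution). Let $0\le l<r\le k$. Let $\tilde X=XQ\in\mathbb R^{n\times r}$ (with a possibly random $Q\in\mathbb R^{N\times r}$) be the reduced signals; assume that almost surely $\operatorname{supp}\tilde X=\operatorname{supp}X$ and any $r$ nonzero rows of $\tilde X$ are linearly independent. Let $S\in\mathbb R^{m\times r}$ satisfy $R(S)=R(A\tilde X)$, where $R(\cdot)$ is the column space, and let the noisy subspace estimate $\tilde S\in\mathbb R^{m\times r}$ be any measurable function of $Y$. Let $I_{k-r},I_{k-r+l}\subset\operatorname{supp}X$ have $k-r$ and $k-r+l$ elements, where $I_{k-r+l}$ is fixed or, more generally, a measurable function of $Y$ and of the on-support atoms $A_{\operatorname{supp}X}$.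 Let $$[A_{I_{k-r}}\ S]=U_1\Sigma_1V_1^{*},\qquad [A_{I_{k-r+l}}\ \tilde S]=\tilde U_1\tilde\Sigma_1\tilde V_1^{*}+\tilde U_0\tilde\Sigma_0\tilde V_0^{*}$$ be singular value decompositions, where $U_1,\tilde U_1$ have $k$ columns, the singular values are in decreasing order, and $\tilde\Sigma_1$ contains the $k$ largest ones of the second matrix; if $\tilde U_1$ is not unique, it is chosen measurably in terms of $Y$ and $A_{\operatorname{supp}X}$. Let $P_V$ and $P_V^\perp$ be the orthogonal projections onto a subspace $V$ and onto $V^\perp$, and let $\|\cdot\|$ be the operator norm. Say that the generalized MUSIC step succeeds if (a) $\|P^{\perp}_{R(\tilde U_1)}\mathbf a_j\|^2>\|P^{\perp}_{R(\tilde U_1)}\mathbf a_q\|^2$ for all $j\notin\operatorname{supp}X$ and all $q\in\operatorname{supp}X$, and (b) every set of at most $r-l$ indices outside $I_{k-r+l}$ whose residuals $\|P^{\perp}_{R(\tilde U_1)}\mathbf a_j\|^2$ are the smallest among the indices outside $I_{k-r+l}$ is contained in $\operatorname{supp}X$, and if it has exactly $r-l$ elements, its union with $I_{k-r+l}$ is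 $\operatorname{supp}X$. Suppose that, as $\nu\to\infty$, $m,n\to\infty$, $(\log n)/m\to0$ and $k/m\to\gamma<1$. If $\gamma>0$, then $$\mathbb P\big(\|P_{R(\tilde U_1)}-P_{R(U_1)}\|<1-\gamma\ \text{ and the generalized MUSIC step does not succeed}\big)\longrightarrow0 .$$ Moreover, for every $\gamma<1$ (including $\gamma=0$) and every $\varepsilon>0$, $$\mathbb P\big(\|P_{R(\tilde U_1)}-P_{R(U_1)}\|<1-\gamma-\varepsilon\ \text{ and the generalized MUSIC step does not succeed}\big)\longrightarrow0 .$$ -/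

import Mathlib

open MeasureTheory ProbabilityTheory Filter Topology
open scoped NNReal

namespace SeqMusic

/-- The row support `{i | row i of X is nonzero}`. -/
noncomputable def rowSupport {n N : ℕ} (X : Matrix (Fin n) (Fin N) ℝ) : Finset (Fin n) := by
  classical exact Finset.univ.filter fun i => X i ≠ 0

/-- The nonzero rows of `X ∈ ℝ^{n × r}` are in general position: any `r` of them are linearly
independent. -/
def NonzeroRowsGeneralPosition {n r : ℕ} (X : Matrix (Fin n) (Fin r) ℝ) : Prop :=
  ∀ J : Finset (Fin n), J ⊆ rowSupport X → J.card = r →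
    LinearIndependent ℝ (fun i : J => X i)

/-- A column of a matrix as a vector of Euclidean space. -/
def colVec {m : ℕ} {κ : Type*} (M : Matrix (Fin m) κ ℝ) (j : κ) : EuclideanSpace ℝ (Fin m) :=
  WithLp.toLp 2 (fun i => M i j)

/-- The range (column space) `R(M)` of a matrix. -/
def colSpace {m : ℕ} {κ : Type*} (M : Matrix (Fin m) κ ℝ) :
    Submodule ℝ (EuclideanSpace ℝ (Fin m)) :=
  Submodule.span ℝ (Set.range (colVec M))

/-- The submatrix `A_I` of the columns with index in `I`. -/
def colSubmatrix {m n : ℕ} (A : Matrix (Fin m) (Fin n) ℝ) (I : Finset (Fin n)) :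
    Matrix (Fin m) I ℝ :=
  A.submatrix id (fun i : I => (i : Fin n))

/-- The augmented matrix `[A_I  S]`. -/
def augmented {m n r : ℕ} (A : Matrix (Fin m) (Fin n) ℝ) (I : Finset (Fin n))
    (S : Matrix (Fin m) (Fin r) ℝ) : Matrix (Fin m) (I ⊕ Fin r) ℝ :=
  Matrix.fromCols (colSubmatrix A I) S

/-- `U₁ ∈ ℝ^{m × k}` consists of left singular vectors of `G` for its `k` largest singular values:
there is a singular value decomposition `G = U₁ Σ₁ V₁ᵀ + U₀ Σ₀ V₀ᵀ` in which `[U₁ U₀]` and `[V₁ V₀]`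
have orthonormal columns and the singular values are nonnegative and in decreasing order.
The block `Σ₀` may omit zero singular values.  If `G` has exactly `k` columns, then `U₀`, `Σ₀`, `V₀`
are empty (orthonormality of `[V₁ V₀]`), and the decomposition reads `G = U₁ Σ₁ V₁ᵀ`. -/
def IsLeadingLeftSingular {m k : ℕ} {ι : Type*} [Fintype ι]
    (G : Matrix (Fin m) ι ℝ) (U₁ : Matrix (Fin m) (Fin k) ℝ) : Prop :=
  ∃ (d : ℕ) (U₀ : Matrix (Fin m) (Fin d) ℝ) (σ₁ : Fin k → ℝ) (σ₀ : Fin d → ℝ)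
    (V₁ : Matrix ι (Fin k) ℝ) (V₀ : Matrix ι (Fin d) ℝ),
    (Matrix.fromCols U₁ U₀).transpose * Matrix.fromCols U₁ U₀ = 1 ∧
    (Matrix.fromCols V₁ V₀).transpose * Matrix.fromCols V₁ V₀ = 1 ∧
    Antitone σ₁ ∧ Antitone σ₀ ∧ (∀ i j, σ₀ j ≤ σ₁ i) ∧ (∀ i, 0 ≤ σ₁ i) ∧ (∀ j, 0 ≤ σ₀ j) ∧
    G = U₁ * Matrix.diagonal σ₁ * V₁.transpose + U₀ * Matrix.diagonal σ₀ * V₀.transpose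

/-- The perturbation `‖P_{R(U')} - P_{R(U)}‖` (operator norm of the difference of the orthogonal
projections). -/
noncomputable def perturbation {m k : ℕ} (U' U : Matrix (Fin m) (Fin k) ℝ) : ℝ :=
  ‖(colSpace U').starProjection - (colSpace U).starProjection‖

/-- The residual `‖P_{R(U)}^⊥ a_j‖²` of the `j`-th atom. -/
noncomputable def residual {m n k : ℕ} (U : Matrix (Fin m) (Fin k) ℝ)
    (A : Matrix (Fin m) (Fin n) ℝ) (j : Fin n) : ℝ :=
  ‖(colSpace U)ᗮ.starProjection (colVec A j)‖ ^ 2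

/-- `J` is a possible output of a generalized MUSIC step started from `I`: a set of indices outside
`I` whose residuals are the smallest among all indices outside `I` (ties are broken arbitrarily). -/
def IsMusicSelection {n : ℕ} (res : Fin n → ℝ) (I J : Finset (Fin n)) : Prop :=
  Disjoint I J ∧ ∀ j ∈ J, ∀ i, i ∉ I → i ∉ J → res j ≤ res i

/-- The noisy multiple measurement vector problem `Y = A X + W` with `m` sensors, ambient dimension
`n`, `N` snapshots and sparsity `k`, together with a partial support of `k - r + l` correct indices
and a noisy rank-`r` signal subspace estimate. -/
structure NoisyMMV (m n N k r l : ℕ) {Ω : Type*} [MeasurableSpace Ω] (μ : Measure Ω) where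
  /-- the sensing matrix: i.i.d. centred Gaussian entries of variance `1/m` -/
  A : Ω → Matrix (Fin m) (Fin n) ℝ
  measurable_A : ∀ i j, Measurable fun ω => A ω i j
  law_A : ∀ i j, μ.map (fun ω => A ω i j) = gaussianReal 0 ((m : ℝ≥0)⁻¹)
  indep_A : iIndepFun (fun (p : Fin m × Fin n) ω => A ω p.1 p.2) μ
  /-- the unknown signals, with `k` nonzero rows -/
  X : Matrix (Fin n) (Fin N) ℝ
  card_supp : (rowSupport X).card = k
  /-- the additive noise, of any distribution, independent of the sensing matrix -/
  W : Ω → Matrix (Fin m) (Fin N) ℝ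
  measurable_W : ∀ i j, Measurable fun ω => W ω i j
  indep_W : IndepFun (fun ω (p : Fin m × Fin n) => A ω p.1 p.2)
    (fun ω (p : Fin m × Fin N) => W ω p.1 p.2) μ
  r_le_k : r ≤ k
  l_lt_r : l < r
  /-- the reduction of the `N` snapshots to `r` of them; the canonical signals are `X * Q ω` -/
  Q : Ω → Matrix (Fin N) (Fin r) ℝ
  supp_reduced : ∀ᵐ ω ∂μ, rowSupport (X * Q ω) = rowSupport X
  generalPosition : ∀ᵐ ω ∂μ, NonzeroRowsGeneralPosition (X * Q ω)
  /-- the noiseless signal subspace `R(S) = R(A X Q)` -/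
  S : Ω → Matrix (Fin m) (Fin r) ℝ
  range_S : ∀ᵐ ω ∂μ, colSpace (S ω) = colSpace (A ω * (X * Q ω))
  /-- the noisy signal subspace estimate, computed from the measurements `Y = A X + W` -/
  Sn : Ω → Matrix (Fin m) (Fin r) ℝ
  measurable_Sn : ∀ i j, Measurable[MeasurableSpace.comap
    (fun ω (p : Fin m × Fin N) => (A ω * X + W ω) p.1 p.2) inferInstance] fun ω => Sn ω i j
  /-- `k - r` correct indices -/
  I₀ : Ω → Finset (Fin n)
  I₀_sub : ∀ᵐ ω ∂μ, I₀ ω ⊆ rowSupport X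
  card_I₀ : ∀ᵐ ω ∂μ, (I₀ ω).card = k - r
  /-- `k - r + l` correct indices, either fixed in advance or determined by the measurements and
  the atoms on the support -/
  I : Ω → Finset (Fin n)
  I_sub : ∀ᵐ ω ∂μ, I ω ⊆ rowSupport X
  card_I : ∀ᵐ ω ∂μ, (I ω).card = k - r + l
  measurable_I : ∀ J : Finset (Fin n), MeasurableSet[MeasurableSpace.comap
    (fun ω => ((fun (p : Fin m × rowSupport X) => A ω p.1 p.2),
      (fun (p : Fin m × Fin N) => (A ω * X + W ω) p.1 p.2))) inferInstance] {ω | I ω = J}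
  /-- the left singular vectors of `[A_{I₀}  S]` -/
  U : Ω → Matrix (Fin m) (Fin k) ℝ
  svd_U : ∀ᵐ ω ∂μ, IsLeadingLeftSingular (augmented (A ω) (I₀ ω) (S ω)) (U ω)
  /-- the `k` leading left singular vectors of `[A_I  Sn]`; if they are not unique, the choice among
  them is made on the basis of the measurements and the atoms on the support -/
  Un : Ω → Matrix (Fin m) (Fin k) ℝ
  svd_Un : ∀ᵐ ω ∂μ, IsLeadingLeftSingular (augmented (A ω) (I ω) (Sn ω)) (Un ω)
  measurable_Un : ∀ i j, Measurable[MeasurableSpace.comap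
    (fun ω => ((fun (p : Fin m × rowSupport X) => A ω p.1 p.2),
      (fun (p : Fin m × Fin N) => (A ω * X + W ω) p.1 p.2))) inferInstance] fun ω => Un ω i j

/-- Every off-support atom has a larger residual than every on-support atom, and the generalized
MUSIC step picks correct indices: selecting at most `r - l` indices it selects support indices only,
and selecting `r - l` indices it completes `I` to the whole support. -/
def NoisyMMV.MusicSucceeds {m n N k r l : ℕ} {Ω : Type*} [MeasurableSpace Ω] {μ : Measure Ω}
    (M : NoisyMMV m n N k r l μ) (ω : Ω) : Prop :=
  (∀ j, j ∉ rowSupport M.X → ∀ q ∈ rowSupport M.X,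
    residual (M.Un ω) (M.A ω) q < residual (M.Un ω) (M.A ω) j) ∧
  (∀ J : Finset (Fin n), IsMusicSelection (residual (M.Un ω) (M.A ω)) (M.I ω) J →
    (J.card ≤ r - l → J ⊆ rowSupport M.X) ∧
    (J.card = r - l → M.I ω ∪ J = rowSupport M.X))

end SeqMusic

/-! ### Exponential moments and tails of the standard Gaussian norm -/

/-! Write η for the perturbation. With exactly k columns, [A_I₀ S] spans every on-support atom
(`colVec_mem_colSpace_augmented`), so R(U₁) contains a_q for q in the support and its residual is at
most η²‖a_q‖² (`residual_le_of_mem_colSpace`). Here ‖a_q‖² is close to 1.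

Off the support, a_j is independent of Ũ₁ (`NoisyMMV.indepFun_Un_scaledAtom`): Y involves A only
through the on-support atoms. Given Ũ₁, m times the residual of a_j is therefore chi-square with at
least m - k degrees of freedom, so the residual is rarely much below 1 - γ.

The two kinds of residual thus separate as soon as η² stays below 1 - γ by a fixed margin. Chernoff
bounds make each exceptional event exponentially unlikely in m, and log n = o(m) pays for the union
over n atoms. The stated threshold follows since (1 - γ)² < 1 - γ for 0 < γ < 1; at γ = 0 the margin
comes from ε. -/

theorem integral_exp_mul_sq_gaussianReal {s : ℝ} (hs : s < 1 / 2) :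
    ∫ x, Real.exp (s * x ^ 2) ∂(gaussianReal 0 1) = (√(1 - 2 * s))⁻¹ := by
  have hb : 0 < 1 / 2 - s := by linarith
  rw [integral_gaussianReal_eq_integral_smul one_ne_zero]
  have h : ∀ x : ℝ, gaussianPDFReal 0 1 x • Real.exp (s * x ^ 2)
      = (√(2 * Real.pi))⁻¹ * Real.exp (-(1 / 2 - s) * x ^ 2) := by
    intro x
    simp only [gaussianPDFReal, smul_eq_mul, NNReal.coe_one, mul_one, sub_zero]
    rw [mul_assoc, ← Real.exp_add]
    congr 2
    ring
  simp_rw [h]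
  rw [integral_const_mul, integral_gaussian, ← Real.sqrt_inv, ← Real.sqrt_inv,
    ← Real.sqrt_mul (by positivity)]
  congr 1
  have h1 : (1 - 2 * s) ≠ 0 := by linarith
  have h2 : (1 / 2 - s) ≠ 0 := hb.ne'
  have := Real.pi_pos.ne'
  field_simp

section StdGaussian

variable {E : Type*} [NormedAddCommGroup E] [InnerProductSpace ℝ E] [FiniteDimensional ℝ E]
  [MeasurableSpace E] [BorelSpace E]

theorem integral_exp_mul_norm_sq_stdGaussian {s : ℝ} (hs : s < 1 / 2) :
    ∫ x, Real.exp (s * ‖x‖ ^ 2) ∂(stdGaussian E) = ((√(1 - 2 * s))⁻¹) ^ Module.finrank ℝ E := by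
  rw [stdGaussian, integral_map (Measurable.aemeasurable (by fun_prop))
    (Measurable.aestronglyMeasurable (by fun_prop))]
  have h : ∀ x : Fin (Module.finrank ℝ E) → ℝ,
      Real.exp (s * ‖∑ i, x i • stdOrthonormalBasis ℝ E i‖ ^ 2)
        = ∏ i, Real.exp (s * x i ^ 2) := by
    intro x
    rw [← Real.exp_sum, ← Finset.mul_sum, ← real_inner_self_eq_norm_sq,
      (stdOrthonormalBasis ℝ E).orthonormal.inner_sum]
    simp [sq]
  simp_rw [h]
  rw [integral_fintype_prod_eq_prod (f := fun _ x => Real.exp (s * x ^ 2))]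
  simp [integral_exp_mul_sq_gaussianReal hs]

theorem integrable_exp_mul_norm_sq_stdGaussian {s : ℝ} (hs : s < 1 / 2) :
    Integrable (fun x => Real.exp (s * ‖x‖ ^ 2)) (stdGaussian E) := by
  -- The Bochner integral of a non-integrable function is 0 by convention, so a nonzero value proves
  -- integrability.
  refine Integrable.of_integral_ne_zero ?_
  rw [integral_exp_mul_norm_sq_stdGaussian hs]
  have : 0 < √(1 - 2 * s) := Real.sqrt_pos.2 (by linarith)
  positivity

/-- This is log y ≤ y - 1 at y = (1 - 2s)⁻¹. Both signs of s are used: negative for the lower tail,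
positive for the upper. -/
theorem inv_sqrt_pow_le {s : ℝ} (hs : s < 1 / 2) (d : ℕ) :
    ((√(1 - 2 * s))⁻¹) ^ d ≤ Real.exp (d * (s / (1 - 2 * s))) := by
  have h1 : 0 < 1 - 2 * s := by linarith
  rw [Real.exp_nat_mul]
  refine pow_le_pow_left₀ (by positivity) ?_ d
  rw [← Real.sqrt_inv, ← Real.exp_log (inv_pos.2 h1), Real.sqrt_eq_rpow, ← Real.exp_mul,
    Real.exp_le_exp]
  have := Real.log_le_sub_one_of_pos (inv_pos.2 h1)
  have h2 : (1 - 2 * s)⁻¹ - 1 = 2 * (s / (1 - 2 * s)) := by field_simp; ring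
  linarith

theorem stdGaussian_norm_sq_le_le {θ : ℝ} (hθ : 0 ≤ θ) (x : ℝ) :
    (stdGaussian E).real {v | ‖v‖ ^ 2 ≤ x}
      ≤ Real.exp (θ * x - Module.finrank ℝ E * (θ / (1 + 2 * θ))) := by
  have hs : -θ < 1 / 2 := by linarith
  refine (measure_le_le_exp_mul_mgf (X := fun v : E => ‖v‖ ^ 2) x (neg_nonpos.2 hθ)
    (integrable_exp_mul_norm_sq_stdGaussian hs)).trans ?_
  rw [mgf, integral_exp_mul_norm_sq_stdGaussian hs, sub_eq_add_neg (θ * x), Real.exp_add, neg_neg]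
  gcongr
  refine (inv_sqrt_pow_le hs _).trans_eq ?_
  congr 1
  ring

theorem stdGaussian_le_norm_sq_le {θ : ℝ} (hθ : 0 ≤ θ) (hθ' : θ < 1 / 2) (x : ℝ) :
    (stdGaussian E).real {v | x ≤ ‖v‖ ^ 2}
      ≤ Real.exp (Module.finrank ℝ E * (θ / (1 - 2 * θ)) - θ * x) := by
  refine (measure_ge_le_exp_mul_mgf (X := fun v : E => ‖v‖ ^ 2) x hθ
    (integrable_exp_mul_norm_sq_stdGaussian hθ')).trans ?_
  rw [mgf, integral_exp_mul_norm_sq_stdGaussian hθ', sub_eq_neg_add (_ * _) (θ * x),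
    Real.exp_add, neg_mul]
  gcongr
  exact inv_sqrt_pow_le hθ' _

/-- The orthogonal projection of a standard Gaussian vector is standard Gaussian. -/
theorem stdGaussian_map_orthogonalProjectionOnto (V : Submodule ℝ E) :
    (stdGaussian E).map V.orthogonalProjectionOnto = stdGaussian V := by
  apply Measure.ext_of_charFun
  ext t
  rw [charFun_stdGaussian, charFun_apply, integral_map (by fun_prop)
    (Measurable.aestronglyMeasurable (by fun_prop))]
  have h := charFun_stdGaussian (t : E)
  rw [charFun_apply] at h
  simp only [Submodule.inner_orthogonalProjectionOnto_eq_of_mem_right]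
  simpa using h

theorem stdGaussian_starProjection_norm_sq_le_le (V : Submodule ℝ E) {θ : ℝ} (hθ : 0 ≤ θ)
    (x : ℝ) :
    (stdGaussian E).real {v | ‖V.starProjection v‖ ^ 2 ≤ x}
      ≤ Real.exp (θ * x - Module.finrank ℝ V * (θ / (1 + 2 * θ))) := by
  refine le_trans (le_of_eq ?_) (stdGaussian_norm_sq_le_le (E := V) hθ x)
  rw [← stdGaussian_map_orthogonalProjectionOnto V, map_measureReal_apply (by fun_prop)
    (measurableSet_le (by fun_prop) (by fun_prop))]
  rfl

end StdGaussian

/-! ### Exponential tail rates uniform in the dimension -/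

/-- Uniform exponential lower tail for the squared norm of the projection of a standard Gaussian
vector onto a subspace whose dimension is a fixed fraction of the ambient dimension. -/
theorem exists_rate_lower_tail {t β : ℝ} (ht : 0 < t) (htβ : t < β) :
    ∃ κ > 0, ∀ (m : ℕ) (V : Submodule ℝ (EuclideanSpace ℝ (Fin m))),
      β * m ≤ Module.finrank ℝ V →
      stdGaussian (EuclideanSpace ℝ (Fin m)) {v | ‖V.starProjection v‖ ^ 2 ≤ t * m}
        ≤ ENNReal.ofReal (Real.exp (-κ * m)) := by
  -- The Chernoff rate is positive exactly when 1 < 1 + 2θ < β/t; this θ puts 1 + 2θ at the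
  -- midpoint.
  set θ : ℝ := (β / t - 1) / 4 with hθ_def
  have h1 : 1 < β / t := (one_lt_div ht).2 htβ
  have hθ : 0 < θ := by rw [hθ_def]; linarith
  have hκ : t < β / (1 + 2 * θ) := by
    rw [lt_div_iff₀ (by positivity), mul_comm, ← lt_div_iff₀ ht]
    linarith
  refine ⟨θ * (β / (1 + 2 * θ) - t), mul_pos hθ (sub_pos.2 hκ), fun m V hV => ?_⟩
  refine (ENNReal.le_ofReal_iff_toReal_le (measure_ne_top _ _) (Real.exp_pos _).le).2 ?_
  refine (stdGaussian_starProjection_norm_sq_le_le V hθ.le (t * m)).trans ?_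
  rw [Real.exp_le_exp]
  have : β * m * (θ / (1 + 2 * θ)) ≤ Module.finrank ℝ V * (θ / (1 + 2 * θ)) := by gcongr
  refine (sub_le_sub_left this _).trans_eq ?_
  ring

/-- Uniform exponential upper tail for the squared norm of a standard Gaussian vector. -/
theorem exists_rate_upper_tail {τ : ℝ} (hτ : 1 < τ) :
    ∃ κ > 0, ∀ m : ℕ,
      stdGaussian (EuclideanSpace ℝ (Fin m)) {v | τ * m ≤ ‖v‖ ^ 2}
        ≤ ENNReal.ofReal (Real.exp (-κ * m)) := by
  have hτ0 : 0 < τ := by linarith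
  have hi : τ⁻¹ < 1 := inv_lt_one_of_one_lt₀ hτ
  have hi0 : 0 < τ⁻¹ := inv_pos.2 hτ0
  -- Here 1 - 2θ is the midpoint of τ⁻¹ and 1.
  set θ : ℝ := (1 - τ⁻¹) / 4 with hθ_def
  have hθ : 0 < θ := by rw [hθ_def]; linarith
  have hθ' : θ < 1 / 2 := by rw [hθ_def]; linarith
  have h2 : 0 < 1 - 2 * θ := by linarith
  have hκ : 1 / (1 - 2 * θ) < τ := by
    rw [one_div]
    exact inv_lt_of_inv_lt₀ hτ0 (by rw [hθ_def]; linarith)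
  refine ⟨θ * (τ - 1 / (1 - 2 * θ)), mul_pos hθ (sub_pos.2 hκ), fun m => ?_⟩
  refine (ENNReal.le_ofReal_iff_toReal_le (measure_ne_top _ _) (Real.exp_pos _).le).2 ?_
  refine (stdGaussian_le_norm_sq_le hθ.le hθ' (τ * m)).trans ?_
  rw [Real.exp_le_exp, finrank_euclideanSpace_fin]
  refine le_of_eq ?_
  ring

/-! ### Independence and the union-bound limit -/

/-- If `X` and `Z` are independent and `(X, Z)` is independent of `W`, then `(X, W)` is independent
of `Z`. -/
theorem indepFun_prodMk_of_indepFun {Ω α β δ : Type*} [MeasurableSpace Ω] [MeasurableSpace α]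
    [MeasurableSpace β] [MeasurableSpace δ] {μ : Measure Ω} [IsProbabilityMeasure μ]
    {X : Ω → α} {Z : Ω → β} {W : Ω → δ} (hX : Measurable X) (hZ : Measurable Z) (hW : Measurable W)
    (hXZ : IndepFun X Z μ) (hW' : IndepFun (fun ω => (X ω, Z ω)) W μ) :
    IndepFun (fun ω => (X ω, W ω)) Z μ := by
  have hXW : IndepFun X W μ := hW'.comp measurable_fst measurable_id
  rw [IndepFun_iff_Indep]
  -- Rectangles form a π-system generating σ(X, W), so the product formula need only be checked on
  -- them.
  refine IndepSets.indep (hX.prodMk hW).comap_le hZ.comap_le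
    (p1 := Set.preimage (fun ω => (X ω, W ω)) ''
      (Set.image2 (fun s t => s ×ˢ t) {s | MeasurableSet s} {t | MeasurableSet t}))
    (p2 := {s | MeasurableSet[MeasurableSpace.comap Z inferInstance] s})
    (isPiSystem_prod.comap _) (@MeasurableSpace.isPiSystem_measurableSet _
      (MeasurableSpace.comap Z inferInstance)) ?_
    (@MeasurableSpace.generateFrom_measurableSet _ (MeasurableSpace.comap Z inferInstance)).symm ?_
  · rw [← generateFrom_prod, MeasurableSpace.comap_generateFrom]
  · rw [IndepSets_iff]
    rintro _ _ ⟨_, ⟨s, hs, t, ht, rfl⟩, rfl⟩ ⟨u, hu, rfl⟩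
    have h1 := hW'.measure_inter_preimage_eq_mul (s ×ˢ u) t (hs.prod hu) ht
    have h2 := hXZ.measure_inter_preimage_eq_mul s u hs hu
    have h3 := hXW.measure_inter_preimage_eq_mul s t hs ht
    rw [Set.mk_preimage_prod] at h1 ⊢
    rw [h3, Set.inter_right_comm, h1, h2, mul_right_comm]

theorem comap_le_of_measurable_apply {Ω ι κ : Type*} {m : MeasurableSpace Ω}
    {f : Ω → ι → κ → ℝ} (h : ∀ i j, Measurable fun ω => f ω i j) :
    MeasurableSpace.comap f inferInstance ≤ m :=
  measurable_iff_comap_le.1 (measurable_pi_lambda _ fun i => measurable_pi_lambda _ (h i))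

/-- If every section of `B` has `ν`-measure at most `p`, and `Z` has law `ν` and is independent of
`X`, then `(X, Z)` lies in `B` with probability at most `p`. -/
theorem measure_prodMk_mem_le_of_indepFun {Ω α β : Type*} [MeasurableSpace Ω] [MeasurableSpace α]
    [MeasurableSpace β] {μ : Measure Ω} [IsProbabilityMeasure μ] {X : Ω → α} {Z : Ω → β}
    (hX : Measurable X) (hZ : Measurable Z) (h : IndepFun X Z μ) {B : Set (α × β)}
    (hB : MeasurableSet B) {p : ENNReal} (hp : ∀ x, μ.map Z (Prod.mk x ⁻¹' B) ≤ p) :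
    μ {ω | (X ω, Z ω) ∈ B} ≤ p := by
  have := Measure.isProbabilityMeasure_map (μ := μ) hX.aemeasurable
  have := Measure.isProbabilityMeasure_map (μ := μ) hZ.aemeasurable
  calc μ {ω | (X ω, Z ω) ∈ B} = μ.map (fun ω => (X ω, Z ω)) B :=
        (Measure.map_apply (hX.prodMk hZ) hB).symm
    _ = ∫⁻ x, μ.map Z (Prod.mk x ⁻¹' B) ∂(μ.map X) := by
        rw [h.map_prod_eq_prod_map_map hX.aemeasurable hZ.aemeasurable, Measure.prod_apply hB]
    _ ≤ ∫⁻ _, p ∂(μ.map X) := lintegral_mono hp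
    _ = p := by simp

/-- Eventually log n < (κ/2) m, so half of the exponential rate absorbs the factor n. -/
theorem tendsto_nat_mul_exp_zero {m n : ℕ → ℕ} (hm : Tendsto m atTop atTop)
    (hlog : Tendsto (fun ν => Real.log (n ν) / (m ν : ℝ)) atTop (𝓝 0)) {κ : ℝ} (hκ : 0 < κ) :
    Tendsto (fun ν => (n ν : ENNReal) * ENNReal.ofReal (Real.exp (-κ * m ν))) atTop (𝓝 0) := by
  have hmR : Tendsto (fun ν => (m ν : ℝ)) atTop atTop := tendsto_natCast_atTop_atTop.comp hm
  have h1 : Tendsto (fun ν => Real.exp (-(κ / 2) * m ν)) atTop (𝓝 0) :=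
    Real.tendsto_exp_atBot.comp (hmR.const_mul_atTop_of_neg (by linarith))
  have h2 := ENNReal.tendsto_ofReal h1
  rw [ENNReal.ofReal_zero] at h2
  refine tendsto_of_tendsto_of_tendsto_of_le_of_le' tendsto_const_nhds h2
    (Eventually.of_forall fun _ => zero_le) ?_
  filter_upwards [hlog.eventually_lt_const (half_pos hκ), hmR.eventually_gt_atTop 0] with ν hν hm0
  rw [← ENNReal.ofReal_natCast, ← ENNReal.ofReal_mul (Nat.cast_nonneg _)]
  apply ENNReal.ofReal_le_ofReal
  rcases Nat.eq_zero_or_pos (n ν) with h0 | h0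
  · rw [h0]; simp; positivity
  · have hn : (0 : ℝ) < n ν := by exact_mod_cast h0
    rw [← Real.exp_log hn, ← Real.exp_add, Real.exp_le_exp]
    rw [div_lt_iff₀ hm0] at hν
    linarith

namespace SeqMusic

/-! ### Column spaces and residuals -/

theorem colVec_mem_colSpace {m : ℕ} {κ : Type*} (M : Matrix (Fin m) κ ℝ) (j : κ) :
    colVec M j ∈ colSpace M :=
  Submodule.subset_span ⟨j, rfl⟩

theorem inner_colVec {m : ℕ} {κ : Type*} (M : Matrix (Fin m) κ ℝ) (i j : κ) :
    inner ℝ (colVec M i) (colVec M j) = (M.transpose * M) i j := by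
  simp [colVec, PiLp.inner_apply, Matrix.mul_apply, mul_comm]

theorem orthonormal_colVec {m : ℕ} {κ : Type*} [DecidableEq κ] {U : Matrix (Fin m) κ ℝ}
    (hU : U.transpose * U = 1) : Orthonormal ℝ (colVec U) := by
  rw [orthonormal_iff_ite]
  intro i j
  rw [inner_colVec, hU, Matrix.one_apply]

theorem colVec_mul {m : ℕ} {κ ι : Type*} [Fintype κ] (M : Matrix (Fin m) κ ℝ)
    (B : Matrix κ ι ℝ) (j : ι) : colVec (M * B) j = ∑ i, B i j • colVec M i := by
  ext x
  simp [colVec, Matrix.mul_apply, mul_comm]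

theorem colSpace_mul_le {m : ℕ} {κ ι : Type*} [Fintype κ] (M : Matrix (Fin m) κ ℝ)
    (B : Matrix κ ι ℝ) : colSpace (M * B) ≤ colSpace M := by
  rw [colSpace, Submodule.span_le]
  rintro _ ⟨j, rfl⟩
  rw [SetLike.mem_coe, colVec_mul]
  exact Submodule.sum_mem _ fun i _ => Submodule.smul_mem _ _ (colVec_mem_colSpace M i)

theorem finrank_colSpace_orthogonal {m k : ℕ} (U : Matrix (Fin m) (Fin k) ℝ) :
    m ≤ Module.finrank ℝ (colSpace U)ᗮ + k := by
  have h1 := Submodule.finrank_add_finrank_orthogonal (colSpace U)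
  have h2 : Module.finrank ℝ (colSpace U) ≤ k :=
    (finrank_range_le_card (R := ℝ) (colVec U)).trans_eq (Fintype.card_fin k)
  rw [finrank_euclideanSpace_fin] at h1
  omega

/-- This makes the residual a polynomial in the entries of U and v, hence jointly measurable, as
conditioning on U requires. -/
theorem norm_sq_orthogonal_starProjection_colSpace {m k : ℕ} {U : Matrix (Fin m) (Fin k) ℝ}
    (hU : U.transpose * U = 1) (v : EuclideanSpace ℝ (Fin m)) :
    ‖(colSpace U)ᗮ.starProjection v‖ ^ 2 = ‖v‖ ^ 2 - ∑ i, (∑ x, U x i * v x) ^ 2 := by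
  have ho := orthonormal_colVec hU
  have hP : (colSpace U).starProjection v = ∑ i, (inner ℝ (colVec U i) v : ℝ) • colVec U i := by
    refine Submodule.eq_starProjection_of_mem_of_inner_eq_zero
      (Submodule.sum_mem _ fun i _ => Submodule.smul_mem _ _ (colVec_mem_colSpace U i)) ?_
    intro w hw
    induction hw using Submodule.span_induction with
    | mem w hw =>
      obtain ⟨j, rfl⟩ := hw
      rw [inner_sub_left, real_inner_comm, real_inner_comm (colVec U j), ho.inner_right_fintype,
        sub_self]
    | zero => simp
    | add x y _ _ hx hy => rw [inner_add_right, hx, hy, add_zero]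
    | smul c x _ hx => rw [inner_smul_right, hx, mul_zero]
  have hn : ‖(colSpace U).starProjection v‖ ^ 2 = ∑ i, (∑ x, U x i * v x) ^ 2 := by
    rw [hP, ← real_inner_self_eq_norm_sq, ho.inner_sum]
    simp [sq, colVec, PiLp.inner_apply, mul_comm]
  have := Submodule.norm_sq_eq_add_norm_sq_starProjection v (colSpace U)
  linarith

/-- Since P_U fixes a_q, the vector P_V^⊥ a_q equals (P_U - P_V) a_q. -/
theorem residual_le_of_mem_colSpace {m n k : ℕ} {U V : Matrix (Fin m) (Fin k) ℝ}
    {A : Matrix (Fin m) (Fin n) ℝ} {q : Fin n} (hq : colVec A q ∈ colSpace U) :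
    residual V A q ≤ perturbation V U ^ 2 * ‖colVec A q‖ ^ 2 := by
  rw [residual, ← mul_pow]
  gcongr
  have h : (colSpace V)ᗮ.starProjection (colVec A q)
      = -((colSpace V).starProjection - (colSpace U).starProjection) (colVec A q) := by
    rw [Submodule.starProjection_orthogonal']
    simp [Submodule.starProjection_eq_self_iff.2 hq]
  rw [h, norm_neg]
  exact ContinuousLinearMap.le_opNorm _ _

/-! ### Leading left singular vectors -/

theorem IsLeadingLeftSingular.transpose_mul_self {m k : ℕ} {ι : Type*} [Fintype ι]
    {G : Matrix (Fin m) ι ℝ} {U : Matrix (Fin m) (Fin k) ℝ} (h : IsLeadingLeftSingular G U) :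
    U.transpose * U = 1 := by
  obtain ⟨d, U₀, σ₁, σ₀, V₁, V₀, hU, -⟩ := h
  rw [Matrix.transpose_fromCols, Matrix.fromRows_mul_fromCols, ← Matrix.fromBlocks_one,
    Matrix.fromBlocks_inj] at hU
  exact hU.1

theorem IsLeadingLeftSingular.colSpace_le {m k : ℕ} {ι : Type*} [Fintype ι]
    {G : Matrix (Fin m) ι ℝ} {U : Matrix (Fin m) (Fin k) ℝ} (h : IsLeadingLeftSingular G U)
    (hk : Fintype.card ι = k) : colSpace G ≤ colSpace U := by
  obtain ⟨d, U₀, σ₁, σ₀, V₁, V₀, -, hV, -, -, -, -, -, hG⟩ := h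
  -- [V₁ V₀] has k + d orthonormal columns in a space of dimension k.
  have hd : d = 0 := by
    have h1 := Matrix.rank_mul_le_right (Matrix.fromCols V₁ V₀).transpose (Matrix.fromCols V₁ V₀)
    rw [hV, Matrix.rank_one] at h1
    have h2 := Matrix.rank_le_card_height (Matrix.fromCols V₁ V₀)
    simp only [Fintype.card_sum, Fintype.card_fin] at h1
    omega
  subst hd
  rw [hG, Subsingleton.elim U₀ 0, Matrix.zero_mul, Matrix.zero_mul, add_zero, Matrix.mul_assoc]
  exact colSpace_mul_le _ _

/-- The augmented matrix `[A_I  S]` spans every atom on the support. -/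
theorem colVec_mem_colSpace_augmented {m n k r : ℕ} {A : Matrix (Fin m) (Fin n) ℝ}
    {X : Matrix (Fin n) (Fin r) ℝ} {S : Matrix (Fin m) (Fin r) ℝ} {I : Finset (Fin n)}
    (hrk : r ≤ k) (hX : (rowSupport X).card = k) (hpos : NonzeroRowsGeneralPosition X)
    (hS : colSpace S = colSpace (A * X)) (hI : I ⊆ rowSupport X) (hIk : I.card = k - r)
    {q : Fin n} (hq : q ∈ rowSupport X) : colVec A q ∈ colSpace (augmented A I S) := by
  classical
  have hI_mem : ∀ i ∈ I, colVec A i ∈ colSpace (augmented A I S) := fun i hi =>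
    colVec_mem_colSpace (augmented A I S) (Sum.inl ⟨i, hi⟩)
  have hS_le : colSpace (A * X) ≤ colSpace (augmented A I S) := by
    rw [← hS, colSpace, Submodule.span_le]
    rintro _ ⟨j, rfl⟩
    exact colVec_mem_colSpace (augmented A I S) (Sum.inr j)
  by_cases hqI : q ∈ I
  · exact hI_mem q hqI
  have hJr : (rowSupport X \ I).card = r := by
    rw [Finset.card_sdiff_of_subset hI]
    omega
  have hli := hpos _ Finset.sdiff_subset hJr
  -- The r rows of X on the support outside I are independent, so some f is 1 on row q and 0 on the
  -- others. As a coefficient vector w, it makes A X w equal to a_q plus a combination of the atoms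
  -- in I.
  obtain ⟨f, hf⟩ : ∃ f : (Fin r → ℝ) →ₗ[ℝ] ℝ,
      ∀ i : (rowSupport X \ I : Finset (Fin n)), f (X i) = if (i : Fin n) = q then 1 else 0 := by
    refine ⟨(Module.Basis.extend hli.linearIndepOn_id).constr ℝ
      (fun v => if (v : Fin r → ℝ) = X q then 1 else 0), fun i => ?_⟩
    have hi : X i ∈ hli.linearIndepOn_id.extend (Set.subset_univ _) :=
      Module.Basis.subset_extend _ ⟨i, rfl⟩
    have hb : X i = Module.Basis.extend hli.linearIndepOn_id ⟨X i, hi⟩ :=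
      (Module.Basis.extend_apply_self hli.linearIndepOn_id ⟨X i, hi⟩).symm
    rw [hb, Module.Basis.constr_basis]
    have hinj : X i = X q ↔ (i : Fin n) = q := by
      refine ⟨fun h => ?_, fun h => by rw [h]⟩
      exact congrArg Subtype.val
        (hli.injective (a₁ := i) (a₂ := ⟨q, Finset.mem_sdiff.2 ⟨hq, hqI⟩⟩) h)
    simp [hinj]
  have hfX : ∀ i, f (X i) = ∑ s, X i s * f (Pi.single s 1) := fun i => by
    conv_lhs => rw [← Finset.univ_sum_single (X i)]
    rw [map_sum]
    refine Finset.sum_congr rfl fun s _ => ?_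
    rw [← smul_eq_mul, ← map_smul, ← Pi.single_smul, smul_eq_mul, mul_one]
  have hcomb : ∑ i, f (X i) • colVec A i ∈ colSpace (augmented A I S) := by
    have : ∑ i, f (X i) • colVec A i = ∑ s, f (Pi.single s 1) • colVec (A * X) s := by
      simp_rw [colVec_mul, hfX, Finset.sum_smul, Finset.smul_sum, smul_smul]
      rw [Finset.sum_comm]
      simp_rw [mul_comm]
    rw [this]
    exact Submodule.sum_mem _ fun s _ =>
      Submodule.smul_mem _ _ (hS_le (colVec_mem_colSpace (A * X) s))
  have hsplit : ∑ i, f (X i) • colVec A i = colVec A q + ∑ i ∈ I, f (X i) • colVec A i := by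
    have h0 : ∀ i, i ∉ insert q I → f (X i) • colVec A i = 0 := by
      intro i hi
      rw [Finset.mem_insert, not_or] at hi
      by_cases hiX : i ∈ rowSupport X
      · rw [hf ⟨i, Finset.mem_sdiff.2 ⟨hiX, hi.2⟩⟩, if_neg hi.1, zero_smul]
      · have : X i = 0 := by simpa [rowSupport] using hiX
        rw [this, map_zero, zero_smul]
    rw [← Finset.sum_subset (Finset.subset_univ (insert q I)) fun i _ hi => h0 i hi,
      Finset.sum_insert hqI, hf ⟨q, Finset.mem_sdiff.2 ⟨hq, hqI⟩⟩, if_pos rfl, one_smul]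
  rw [hsplit] at hcomb
  exact (Submodule.add_mem_iff_left _
    (Submodule.sum_mem _ fun i hi => Submodule.smul_mem _ _ (hI_mem i hi))).1 hcomb

/-! ### Selection by residuals -/

/-- A selected j outside T would force all of T \ I into J, since those indices have smaller
residuals; then J, with j in addition, is too large. -/
theorem IsMusicSelection.subset_of_separated {n : ℕ} {res : Fin n → ℝ} {T I J : Finset (Fin n)}
    (hsep : ∀ j, j ∉ T → ∀ q ∈ T, res q < res j) (hJ : IsMusicSelection res I J)
    (hcard : J.card ≤ (T \ I).card) : J ⊆ T := by
  intro j hj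
  by_contra hjT
  have hsub : T \ I ⊆ J.erase j := by
    intro i hi
    rw [Finset.mem_sdiff] at hi
    refine Finset.mem_erase.2 ⟨fun h => hjT (h ▸ hi.1), ?_⟩
    by_contra hiJ
    exact absurd (hJ.2 j hj i hi.2 hiJ) (not_le.2 (hsep j hjT i hi.1))
  have h1 := Finset.card_le_card hsub
  have h2 := Finset.card_erase_lt_of_mem hj
  omega

theorem NoisyMMV.musicSucceeds_of_separated {m n N k r l : ℕ} {Ω : Type*} [MeasurableSpace Ω]
    {μ : Measure Ω} (M : NoisyMMV m n N k r l μ) {ω : Ω} (hI : M.I ω ⊆ rowSupport M.X)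
    (hIk : (M.I ω).card = k - r + l)
    (hsep : ∀ j, j ∉ rowSupport M.X → ∀ q ∈ rowSupport M.X,
      residual (M.Un ω) (M.A ω) q < residual (M.Un ω) (M.A ω) j) : M.MusicSucceeds ω := by
  have h1 := M.r_le_k
  have h2 := M.l_lt_r
  have h3 := M.card_supp
  have hc : (rowSupport M.X \ M.I ω).card = r - l := by
    rw [Finset.card_sdiff_of_subset hI]
    omega
  refine ⟨hsep, fun J hJ => ⟨fun hle => hJ.subset_of_separated hsep (hc ▸ hle), fun heq => ?_⟩⟩
  refine Finset.eq_of_subset_of_card_le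
    (Finset.union_subset hI (hJ.subset_of_separated hsep (hc ▸ heq.le))) ?_
  rw [Finset.card_union_of_disjoint hJ.1]
  omega

/-- Success of the generalized MUSIC step when the atoms on the support are not too long and the
residuals of the other atoms are not too small. -/
theorem NoisyMMV.ae_musicSucceeds {m n N k r l : ℕ} {Ω : Type*} [MeasurableSpace Ω]
    {μ : Measure Ω} (M : NoisyMMV m n N k r l μ) {c t τ : ℝ} (hc : 0 < c) (ht : c * τ ≤ t) :
    ∀ᵐ ω ∂μ, perturbation (M.Un ω) (M.U ω) ^ 2 ≤ c →
      (∀ q, ‖colVec (M.A ω) q‖ ^ 2 < τ) →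
      (∀ j, j ∉ rowSupport M.X → t < residual (M.Un ω) (M.A ω) j) → M.MusicSucceeds ω := by
  filter_upwards [M.supp_reduced, M.generalPosition, M.range_S, M.I₀_sub, M.card_I₀, M.I_sub,
    M.card_I, M.svd_U] with ω hsupp hpos hS hI₀ hI₀k hI hIk hU hpert hnorm hres
  refine M.musicSucceeds_of_separated hI hIk fun j hj q hq => ?_
  have hcard : Fintype.card (M.I₀ ω ⊕ Fin r) = k := by
    have := M.r_le_k
    simp only [Fintype.card_sum, Fintype.card_coe, Fintype.card_fin]
    omega
  have hmem : colVec (M.A ω) q ∈ colSpace (M.U ω) :=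
    hU.colSpace_le hcard (colVec_mem_colSpace_augmented M.r_le_k
      (hsupp ▸ M.card_supp) hpos hS (hsupp ▸ hI₀) hI₀k (hsupp ▸ hq))
  calc residual (M.Un ω) (M.A ω) q
      ≤ perturbation (M.Un ω) (M.U ω) ^ 2 * ‖colVec (M.A ω) q‖ ^ 2 :=
        residual_le_of_mem_colSpace hmem
    _ ≤ c * ‖colVec (M.A ω) q‖ ^ 2 := by gcongr
    _ ≤ c * τ := by gcongr; exact (hnorm q).le
    _ ≤ t := ht
    _ < residual (M.Un ω) (M.A ω) j := hres j hj

end SeqMusic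

namespace SeqMusic

/-! ### Gaussian atoms and the failure probability -/

section Probability

variable {m n N k r l : ℕ} {Ω : Type*} [MeasurableSpace Ω] {μ : Measure Ω}

/-- An atom rescaled to have independent standard Gaussian coordinates. -/
noncomputable def NoisyMMV.scaledAtom (M : NoisyMMV m n N k r l μ) (j : Fin n) (ω : Ω) :
    EuclideanSpace ℝ (Fin m) :=
  √m • colVec (M.A ω) j

theorem NoisyMMV.scaledAtom_eq (M : NoisyMMV m n N k r l μ) (j : Fin n) :
    M.scaledAtom j = (fun a : Fin m → ℝ => √m • WithLp.toLp 2 a) ∘ fun ω i => M.A ω i j :=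
  rfl

theorem NoisyMMV.measurable_scaledAtom (M : NoisyMMV m n N k r l μ) (j : Fin n) :
    Measurable (M.scaledAtom j) := by
  rw [M.scaledAtom_eq]
  exact Measurable.comp (by fun_prop) (measurable_pi_lambda _ fun i => M.measurable_A i j)

theorem NoisyMMV.norm_sq_scaledAtom (M : NoisyMMV m n N k r l μ) (j : Fin n) (ω : Ω) :
    ‖M.scaledAtom j ω‖ ^ 2 = ‖colVec (M.A ω) j‖ ^ 2 * m := by
  rw [scaledAtom, norm_smul, mul_pow, Real.norm_of_nonneg (Real.sqrt_nonneg _),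
    Real.sq_sqrt (Nat.cast_nonneg _), mul_comm]

theorem NoisyMMV.norm_sq_starProjection_scaledAtom (M : NoisyMMV m n N k r l μ) (j : Fin n)
    (ω : Ω) (U : Matrix (Fin m) (Fin k) ℝ) :
    ‖(colSpace U)ᗮ.starProjection (M.scaledAtom j ω)‖ ^ 2 = residual U (M.A ω) j * m := by
  rw [scaledAtom, map_smul, norm_smul, mul_pow, Real.norm_of_nonneg (Real.sqrt_nonneg _),
    Real.sq_sqrt (Nat.cast_nonneg _), mul_comm, residual]

theorem NoisyMMV.map_scaledAtom (M : NoisyMMV m n N k r l μ) (hm : 0 < m) (j : Fin n) :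
    μ.map (M.scaledAtom j) = stdGaussian (EuclideanSpace ℝ (Fin m)) := by
  have hm0 : (m : ℝ) ≠ 0 := by exact_mod_cast hm.ne'
  have hmeas : ∀ i, Measurable fun ω => √m * M.A ω i j := fun i =>
    (M.measurable_A i j).const_mul _
  have hind : iIndepFun (fun (i : Fin m) ω => √m * M.A ω i j) μ :=
    (M.indep_A.precomp (g := fun i : Fin m => (i, j)) fun a b h => (Prod.ext_iff.1 h).1).comp
      (fun _ x => √m * x) fun _ => by fun_prop
  have hlaw : ∀ i, μ.map (fun ω => √m * M.A ω i j) = gaussianReal 0 1 := fun i => by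
    have h : (fun ω => √m * M.A ω i j) = (fun x => √m * x) ∘ fun ω => M.A ω i j := rfl
    rw [h, ← Measure.map_map (by fun_prop) (M.measurable_A i j), M.law_A,
      gaussianReal_map_const_mul, mul_zero]
    congr 1
    ext
    simp [Real.sq_sqrt, hm0]
  have h : M.scaledAtom j = WithLp.toLp 2 ∘ fun ω (i : Fin m) => √m * M.A ω i j := by
    funext ω
    ext i
    simp [scaledAtom, colVec]
  rw [h, ← Measure.map_map (by fun_prop) (measurable_pi_lambda _ hmeas),
    hind.map_fun_eq_pi_map fun i => (hmeas i).aemeasurable]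
  simp_rw [hlaw]
  exact map_pi_eq_stdGaussian

/-- The chosen singular vectors are independent of every atom off the support. -/
theorem NoisyMMV.indepFun_Un_scaledAtom [IsProbabilityMeasure μ] (M : NoisyMMV m n N k r l μ)
    {j : Fin n} (hj : j ∉ rowSupport M.X) :
    IndepFun (fun ω (i : Fin m) (s : Fin k) => M.Un ω i s) (M.scaledAtom j) μ := by
  classical
  set AT : Ω → (Fin m × rowSupport M.X → ℝ) := fun ω p => M.A ω p.1 p.2 with hAT
  set a : Ω → (Fin m → ℝ) := fun ω i => M.A ω i j with ha
  set W : Ω → (Fin m × Fin N → ℝ) := fun ω p => M.W ω p.1 p.2 with hW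
  have hATm : Measurable AT := measurable_pi_lambda _ fun p => M.measurable_A _ _
  have ham : Measurable a := measurable_pi_lambda _ fun i => M.measurable_A _ _
  have hWm : Measurable W := measurable_pi_lambda _ fun p => M.measurable_W _ _
  have h1 : IndepFun AT a μ := by
    have h := M.indep_A.indepFun_finset (Finset.univ ×ˢ rowSupport M.X) (Finset.univ ×ˢ {j})
      (Finset.disjoint_product.2 (Or.inr (Finset.disjoint_singleton_right.2 hj)))
      fun p => M.measurable_A _ _
    exact h.comp
      (φ := fun x (p : Fin m × rowSupport M.X) =>
        x ⟨(p.1, p.2), Finset.mem_product.2 ⟨Finset.mem_univ _, p.2.2⟩⟩)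
      (ψ := fun x (i : Fin m) =>
        x ⟨(i, j), Finset.mem_product.2 ⟨Finset.mem_univ _, Finset.mem_singleton_self j⟩⟩)
      (by fun_prop) (by fun_prop)
  have h2 : IndepFun (fun ω => (AT ω, a ω)) W μ :=
    M.indep_W.comp
      (φ := fun x : Fin m × Fin n → ℝ => (((fun p => x (p.1, p.2)), fun i => x (i, j)) :
        (Fin m × rowSupport M.X → ℝ) × (Fin m → ℝ)))
      (ψ := id) (by fun_prop) measurable_id
  have h3 := indepFun_prodMk_of_indepFun hATm ham hWm h1 h2
  have h4 : IndepFun (fun ω => (AT ω, fun p : Fin m × Fin N => (M.A ω * M.X + M.W ω) p.1 p.2))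
      (M.scaledAtom j) μ := by
    -- Rows of X off the support vanish, so Y is a function of the on-support atoms and W alone.
    have hY : (fun ω => (AT ω, fun p : Fin m × Fin N => (M.A ω * M.X + M.W ω) p.1 p.2))
        = (fun z : (Fin m × rowSupport M.X → ℝ) × (Fin m × Fin N → ℝ) =>
          (z.1, fun p : Fin m × Fin N =>
            ∑ i : rowSupport M.X, z.1 (p.1, i) * M.X i p.2 + z.2 p)) ∘ fun ω => (AT ω, W ω) := by
      funext ω
      refine Prod.ext rfl (funext fun p => ?_)
      simp only [Function.comp_apply, Matrix.add_apply, Matrix.mul_apply, hAT, hW]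
      congr 1
      rw [Finset.sum_coe_sort (rowSupport M.X) fun i => M.A ω p.1 i * M.X i p.2]
      refine (Finset.sum_subset (Finset.subset_univ _) fun i _ hi => ?_).symm
      have : M.X i = 0 := by simpa [rowSupport] using hi
      rw [this, Pi.zero_apply, mul_zero]
    rw [hY, M.scaledAtom_eq]
    exact h3.comp (by fun_prop) (by fun_prop)
  rw [IndepFun_iff_Indep] at h4 ⊢
  refine indep_of_indep_of_le_left h4 (comap_le_of_measurable_apply M.measurable_Un)

theorem NoisyMMV.measurable_Un_ambient (M : NoisyMMV m n N k r l μ) :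
    Measurable fun ω (i : Fin m) (s : Fin k) => M.Un ω i s := by
  refine measurable_pi_iff.2 fun i => measurable_pi_iff.2 fun s =>
    (M.measurable_Un i s).mono ?_ le_rfl
  refine Measurable.comap_le (Measurable.prodMk (measurable_pi_lambda _ fun p => M.measurable_A _ _)
    (measurable_pi_lambda _ fun p => ?_))
  simp only [Matrix.add_apply, Matrix.mul_apply]
  have := M.measurable_A
  have := M.measurable_W
  fun_prop

theorem NoisyMMV.measure_residual_le [IsProbabilityMeasure μ] (M : NoisyMMV m n N k r l μ)
    (hm : 0 < m) {t : ℝ} {p : ENNReal}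
    (hp : ∀ V : Submodule ℝ (EuclideanSpace ℝ (Fin m)), m ≤ Module.finrank ℝ V + k →
      stdGaussian (EuclideanSpace ℝ (Fin m)) {v | ‖V.starProjection v‖ ^ 2 ≤ t * m} ≤ p)
    {j : Fin n} (hj : j ∉ rowSupport M.X) :
    μ {ω | residual (M.Un ω) (M.A ω) j ≤ t} ≤ p := by
  -- Orthonormality is built into B so that sections over other matrices u are empty and the section
  -- bound holds for every u.
  set B : Set ((Fin m → Fin k → ℝ) × EuclideanSpace ℝ (Fin m)) :=
    {z | (∀ i s, ∑ x, z.1 x i * z.1 x s = (1 : Matrix (Fin k) (Fin k) ℝ) i s) ∧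
      ‖z.2‖ ^ 2 - ∑ i, (∑ x, z.1 x i * z.2 x) ^ 2 ≤ t * m} with hB_def
  have hB : MeasurableSet B := by
    have h2 : MeasurableSet {z : (Fin m → Fin k → ℝ) × EuclideanSpace ℝ (Fin m) |
        ‖z.2‖ ^ 2 - ∑ i, (∑ x, z.1 x i * z.2 x) ^ 2 ≤ t * m} :=
      measurableSet_le (by fun_prop) (by fun_prop)
    have h1 : MeasurableSet {z : (Fin m → Fin k → ℝ) × EuclideanSpace ℝ (Fin m) |
        ∀ i s, ∑ x, z.1 x i * z.1 x s = (1 : Matrix (Fin k) (Fin k) ℝ) i s} := by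
      simp only [Set.ofPred_forall]
      exact MeasurableSet.iInter fun i => MeasurableSet.iInter fun s =>
        measurableSet_eq_fun (by fun_prop) (by fun_prop)
    exact h1.inter h2
  have hmul : ∀ u : Matrix (Fin m) (Fin k) ℝ,
      (∀ i s, ∑ x, u x i * u x s = (1 : Matrix (Fin k) (Fin k) ℝ) i s) ↔ u.transpose * u = 1 :=
    fun u => by
      rw [← Matrix.ext_iff]
      simp [Matrix.mul_apply]
  refine le_trans ?_ (measure_prodMk_mem_le_of_indepFun M.measurable_Un_ambient
    (M.measurable_scaledAtom j) (M.indepFun_Un_scaledAtom hj) hB (p := p) fun u => ?_)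
  · refine measure_mono_ae ?_
    filter_upwards [M.svd_Un] with ω hω hle
    have hU := hω.transpose_mul_self
    refine ⟨(hmul (M.Un ω)).2 hU, ?_⟩
    rw [← norm_sq_orthogonal_starProjection_colSpace hU, M.norm_sq_starProjection_scaledAtom]
    have hle' : residual (M.Un ω) (M.A ω) j ≤ t := hle
    gcongr
  · rw [M.map_scaledAtom hm]
    by_cases hu : (Matrix.of u).transpose * Matrix.of u = 1
    · refine (measure_mono fun v hv => ?_).trans
        (hp (colSpace (Matrix.of u))ᗮ (finrank_colSpace_orthogonal _))
      have hv2 := hv.2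
      exact (norm_sq_orthogonal_starProjection_colSpace hu v).trans_le hv2
    · have : Prod.mk u ⁻¹' B = ∅ := by
        ext v
        simp only [Set.mem_preimage, Set.mem_empty_iff_false, iff_false]
        exact fun hv => hu ((hmul (Matrix.of u)).1 hv.1)
      rw [this, measure_empty]
      exact zero_le

/-- Only the marginal law of the atom enters, so the dependence of Ũ₁ on the on-support atoms is
harmless. -/
theorem NoisyMMV.measure_le_norm_sq_le (M : NoisyMMV m n N k r l μ)
    (hm : 0 < m) {τ : ℝ} {p : ENNReal}
    (hp : stdGaussian (EuclideanSpace ℝ (Fin m)) {v | τ * m ≤ ‖v‖ ^ 2} ≤ p) (j : Fin n) :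
    μ {ω | τ ≤ ‖colVec (M.A ω) j‖ ^ 2} ≤ p := by
  rw [← M.map_scaledAtom hm j, Measure.map_apply (M.measurable_scaledAtom j)
    (measurableSet_le (by fun_prop) (by fun_prop))] at hp
  refine (measure_mono fun ω hω => ?_).trans hp
  rw [Set.mem_preimage, Set.mem_ofPred_eq, M.norm_sq_scaledAtom]
  have hω' : τ ≤ ‖colVec (M.A ω) j‖ ^ 2 := hω
  gcongr

/-- Union bound for the failure of the generalized MUSIC step at a small perturbation. -/
theorem NoisyMMV.measure_not_musicSucceeds_le [IsProbabilityMeasure μ]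
    (M : NoisyMMV m n N k r l μ) (hm : 0 < m) {c t τ : ℝ} (hc : 0 < c) (ht : c * τ ≤ t)
    {p₁ p₂ : ENNReal}
    (hp₁ : ∀ V : Submodule ℝ (EuclideanSpace ℝ (Fin m)), m ≤ Module.finrank ℝ V + k →
      stdGaussian (EuclideanSpace ℝ (Fin m)) {v | ‖V.starProjection v‖ ^ 2 ≤ t * m} ≤ p₁)
    (hp₂ : stdGaussian (EuclideanSpace ℝ (Fin m)) {v | τ * m ≤ ‖v‖ ^ 2} ≤ p₂) :
    μ {ω | perturbation (M.Un ω) (M.U ω) ^ 2 ≤ c ∧ ¬ M.MusicSucceeds ω} ≤ n * p₁ + n * p₂ := by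
  -- The event need not be measurable, as U₁ is not assumed to be; monotonicity and subadditivity of
  -- the outer measure suffice.
  have hsub : μ {ω | perturbation (M.Un ω) (M.U ω) ^ 2 ≤ c ∧ ¬ M.MusicSucceeds ω}
      ≤ μ ((⋃ j, {ω | j ∉ rowSupport M.X ∧ residual (M.Un ω) (M.A ω) j ≤ t}) ∪
        ⋃ j, {ω | τ ≤ ‖colVec (M.A ω) j‖ ^ 2}) := by
    refine measure_mono_ae ?_
    filter_upwards [M.ae_musicSucceeds hc ht] with ω hω hbad
    by_contra hnot
    refine hbad.2 (hω hbad.1 (fun q => ?_) fun j hj => ?_)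
    · by_contra hq
      exact hnot (Or.inr (Set.mem_iUnion.2 ⟨q, not_lt.1 hq⟩))
    · by_contra hr
      exact hnot (Or.inl (Set.mem_iUnion.2 ⟨j, hj, not_lt.1 hr⟩))
  refine hsub.trans ((measure_union_le _ _).trans (add_le_add ?_ ?_))
  · refine (measure_iUnion_fintype_le _ _).trans
      ((Finset.sum_le_sum (g := fun _ => p₁) fun j _ => ?_).trans ?_)
    · by_cases hj : j ∈ rowSupport M.X
      · simp [hj]
      · simpa [hj] using M.measure_residual_le hm hp₁ hj
    · simp
  · refine (measure_iUnion_fintype_le _ _).trans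
      ((Finset.sum_le_sum (g := fun _ => p₂) fun j _ => M.measure_le_norm_sq_le hm hp₂ j).trans ?_)
    simp

end Probability

/-- The probability that the perturbation is at most a level below `1 - γ` while the generalized
MUSIC step fails vanishes asymptotically. -/
theorem tendsto_measure_not_musicSucceeds {m n N k r l : ℕ → ℕ} {Ω : ℕ → Type*}
    [∀ ν, MeasurableSpace (Ω ν)] {μ : ∀ ν, Measure (Ω ν)} [∀ ν, IsProbabilityMeasure (μ ν)]
    (M : ∀ ν, NoisyMMV (m ν) (n ν) (N ν) (k ν) (r ν) (l ν) (μ ν)) {γ c : ℝ}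
    (hm : Tendsto m atTop atTop)
    (hlog : Tendsto (fun ν => Real.log (n ν) / (m ν : ℝ)) atTop (𝓝 0))
    (hkm : Tendsto (fun ν => (k ν : ℝ) / (m ν : ℝ)) atTop (𝓝 γ)) (hc : 0 < c) (hcγ : c < 1 - γ) :
    Tendsto (fun ν => μ ν {ω |
      perturbation ((M ν).Un ω) ((M ν).U ω) ^ 2 ≤ c ∧ ¬ (M ν).MusicSucceeds ω}) atTop (𝓝 0) := by
  -- With c < t < β < 1 - γ, t bounds off-support residuals from below, β is eventually below (m -
  -- k)/m, and τ = t/c > 1 bounds the squared atom norms.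
  obtain ⟨β, hcβ, hβ⟩ := exists_between hcγ
  obtain ⟨t, hct, htβ⟩ := exists_between hcβ
  obtain ⟨κ₁, hκ₁, h₁⟩ := exists_rate_lower_tail (hc.trans hct) htβ
  obtain ⟨κ₂, hκ₂, h₂⟩ := exists_rate_upper_tail ((one_lt_div hc).2 hct)
  have hlim := (tendsto_nat_mul_exp_zero hm hlog hκ₁).add (tendsto_nat_mul_exp_zero hm hlog hκ₂)
  rw [add_zero] at hlim
  refine tendsto_of_tendsto_of_tendsto_of_le_of_le' tendsto_const_nhds hlim
    (Eventually.of_forall fun _ => zero_le) ?_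
  filter_upwards [hm.eventually_gt_atTop 0, hkm.eventually_lt_const (u := 1 - β) (by linarith)]
    with ν hm0 hν
  have hm0' : (0 : ℝ) < m ν := by exact_mod_cast hm0
  rw [div_lt_iff₀ hm0'] at hν
  refine (M ν).measure_not_musicSucceeds_le hm0 hc (mul_div_cancel₀ t hc.ne').le
    (fun V hV => h₁ (m ν) V ?_) (h₂ (m ν))
  have hV' : (m ν : ℝ) ≤ Module.finrank ℝ V + k ν := by exact_mod_cast hV
  linarith

end SeqMusic

theorem mainTheorem5
    (m n N k r l : ℕ → ℕ)
    (Ω : ℕ → Type*) [∀ ν, MeasurableSpace (Ω ν)]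
    (μ : ∀ ν, Measure (Ω ν)) [∀ ν, IsProbabilityMeasure (μ ν)]
    (M : ∀ ν, SeqMusic.NoisyMMV (m ν) (n ν) (N ν) (k ν) (r ν) (l ν) (μ ν))
    (γ : ℝ) (hγ : γ < 1)
    (hm : Tendsto m atTop atTop) (hn : Tendsto n atTop atTop)
    (hlog : Tendsto (fun ν => Real.log (n ν) / (m ν : ℝ)) atTop (𝓝 0))
    (hkm : Tendsto (fun ν => (k ν : ℝ) / (m ν : ℝ)) atTop (𝓝 γ)) :
    (0 < γ →
      Tendsto (fun ν => μ ν {ω |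
        SeqMusic.perturbation ((M ν).Un ω) ((M ν).U ω) < 1 - γ ∧ ¬ (M ν).MusicSucceeds ω})
        atTop (𝓝 0)) ∧
    (∀ ε : ℝ, 0 < ε →
      Tendsto (fun ν => μ ν {ω |
        SeqMusic.perturbation ((M ν).Un ω) ((M ν).U ω) < 1 - γ - ε ∧ ¬ (M ν).MusicSucceeds ω})
        atTop (𝓝 0)) := by
  have hγ0 : 0 ≤ γ := ge_of_tendsto' hkm fun ν => by positivity
  have key : ∀ δ : ℝ, 0 < δ → δ ^ 2 < 1 - γ →
      Tendsto (fun ν => μ ν {ω |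
        SeqMusic.perturbation ((M ν).Un ω) ((M ν).U ω) < δ ∧ ¬ (M ν).MusicSucceeds ω})
        atTop (𝓝 0) := fun δ hδ hδγ =>
    tendsto_of_tendsto_of_tendsto_of_le_of_le tendsto_const_nhds
      (SeqMusic.tendsto_measure_not_musicSucceeds M hm hlog hkm (pow_pos hδ 2) hδγ)
      (fun _ => zero_le) fun ν => measure_mono fun ω hω =>
        ⟨pow_le_pow_left₀ (norm_nonneg _) hω.1.le 2, hω.2⟩
  refine ⟨fun h => key _ (by linarith) (by nlinarith), fun ε hε => ?_⟩
  rcases le_or_gt (1 - γ - ε) 0 with h | h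
  -- A nonpositive threshold cannot exceed an operator norm.
  · have hempty : ∀ ν, {ω | SeqMusic.perturbation ((M ν).Un ω) ((M ν).U ω) < 1 - γ - ε ∧
        ¬ (M ν).MusicSucceeds ω} = ∅ := fun ν =>
      Set.eq_empty_of_forall_notMem fun ω hω => absurd (norm_nonneg _) (not_le.2 (hω.1.trans_le h))
    simp [hempty]
  -- Here δ = 1 - γ - ε satisfies 0 < δ < 1 - γ ≤ 1, hence δ² ≤ δ < 1 - γ.
  · exact key _ h (by nlinarith)
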